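/- **Query model.** Let $d\ge 1$ and $T\ge 0$ be integers. A $T$-query quantum algorithm for a $d\times d$ unitary $U$ acts on a control qubit, a $d$-dimensional query register and an ancilla register of arbitrary finite dimension $m\ge 1$. It starts in a computational basis state, applies fixed unitaries $A_0,A_1,\dots,A_T$ that do not depend on $U$, and between $A_{j}$ and $A_{j+1}$ it makes one query, that is, it applies either $\mathrm{c}U=|0\rangle\langle 0|\otimes I\otimes I+|1\rangle\langle 1|\otimes U\otimes I$ or $\mathrm{c}U^*$ (which of the two is fixed in advance for each $j$). At the end all registers are measured in the computational basis, and the algorithm accepts if the outcome lies in a fixed set. **Recurrence Time problem.** Let $t\ge 1$ be an integer and $\epsilon>0$. For real numbers $a>b$, a query algorithm solves the $(t,\epsilon)$-Recurrence Time problem for $d$-dimensional unitaries with acceptance probabilities $(a,b)$ if it accepts every $d\times d$ unitary $U$ with $U^t=I$ with probability at least $a$, and every $d\times d$ unitary $U$ with $\|U^t-I\|\ge\epsilon$ (spectral norm) with probability at most $b$. The usual choice is $a=2/3$, $b=1/3$. **Theorem.** For all real numbers $a>b$ there is a constant $c>0$, depending only on $a$ and $b$, such that for all integers $d\ge 1$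 and $t\ge 1$ and all real $0<\epsilon\le \frac1{2\pi}$, every quantum query algorithm that solves the $(t,\epsilon)$-Recurrence Time problem for $d$-dimensional unitaries with acceptance probabilities $(a,b)$ makes $$T\;\ge\; c\,\max\!\left(\frac{t}{\epsilon},\,\sqrt d\right)$$ queries. In particular, for $a=2/3$ and $b=1/3$, $T=\Omega(\max(t/\epsilon,\sqrt d))$. -/

import Mathlib

open scoped Matrix Kronecker Matrix.Norms.L2Operator

noncomputable section

/-- A `d`-dimensional unitary property: a set of *yes* instances and a set of *no* instances
among the `d × d` unitary matrices. -/
structure UnitaryProperty (d : ℕ) where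
  yes : Set (Matrix.unitaryGroup (Fin d) ℂ)
  no : Set (Matrix.unitaryGroup (Fin d) ℂ)

/-- The `(t, ε)`-Recurrence Time problem in dimension `d`: decide `U ^ t = I` versus
`‖U ^ t - I‖ ≥ ε`. The norm is the spectral norm, i.e. the operator norm on `ℂ ^ d` with its
Euclidean norm (scope `Matrix.Norms.L2Operator`). -/
def recurrenceTime (d t : ℕ) (ε : ℝ) : UnitaryProperty d where
  yes := {U | U ^ t = 1}
  no := {U | ε ≤ ‖(U : Matrix (Fin d) (Fin d) ℂ) ^ t - 1‖}

/-- The operator `|0⟩⟨0| ⊗ I ⊗ I + |1⟩⟨1| ⊗ U ⊗ I` on (control qubit) ⊗ (query register) ⊗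
(ancilla register of dimension `m`). -/
def controlled {d : ℕ} (m : ℕ) (U : Matrix (Fin d) (Fin d) ℂ) :
    Matrix (Fin 2 × Fin d × Fin m) (Fin 2 × Fin d × Fin m) ℂ :=
  Matrix.single (0 : Fin 2) (0 : Fin 2) (1 : ℂ) ⊗ₖ
      ((1 : Matrix (Fin d) (Fin d) ℂ) ⊗ₖ (1 : Matrix (Fin m) (Fin m) ℂ)) +
    Matrix.single (1 : Fin 2) (1 : Fin 2) (1 : ℂ) ⊗ₖ
      (U ⊗ₖ (1 : Matrix (Fin m) (Fin m) ℂ))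

/-- A quantum algorithm making `T` queries to a `d × d` unitary or to its inverse: fixed unitaries
`A 0, …, A T` interleaved with `T` applications of the controlled unitary or of its adjoint,
started in a basis state and followed by a measurement in the computational basis. -/
structure QueryAlgorithm (d T : ℕ) where
  /-- dimension of the ancilla register -/
  m : ℕ
  /-- the initial basis state -/
  init : Fin 2 × Fin d × Fin m
  /-- the unitaries between the queries, independent of the oracle -/
  A : Fin (T + 1) → Matrix.unitaryGroup (Fin 2 × Fin d × Fin m) ℂ
  /-- whether a query is made to the inverse -/
  inverse : Fin T → Bool
  /-- the measurement outcomes on which the algorithm accepts -/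
  accept : Finset (Fin 2 × Fin d × Fin m)

namespace QueryAlgorithm

variable {d T : ℕ}

/-- The operator applied to the state by the `j`-th query (`star` is the conjugate transpose). -/
def query (alg : QueryAlgorithm d T) (U : Matrix.unitaryGroup (Fin d) ℂ) (j : Fin T) :
    Matrix (Fin 2 × Fin d × Fin alg.m) (Fin 2 × Fin d × Fin alg.m) ℂ :=
  controlled alg.m (if alg.inverse j then star (U : Matrix (Fin d) (Fin d) ℂ) else U)

/-- The state after `j` queries and the unitary `A j`. -/
def state (alg : QueryAlgorithm d T) (U : Matrix.unitaryGroup (Fin d) ℂ) (j : Fin (T + 1)) :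
    Fin 2 × Fin d × Fin alg.m → ℂ :=
  Fin.induction (motive := fun _ => Fin 2 × Fin d × Fin alg.m → ℂ)
    ((alg.A 0 : Matrix _ _ ℂ) *ᵥ Pi.single alg.init 1)
    (fun i ψ => (alg.A i.succ : Matrix _ _ ℂ) *ᵥ (alg.query U i *ᵥ ψ)) j

/-- The probability that the algorithm accepts when it queries `U`. -/
def acceptProb (alg : QueryAlgorithm d T) (U : Matrix.unitaryGroup (Fin d) ℂ) : ℝ :=
  ∑ x ∈ alg.accept, ‖alg.state U (Fin.last T) x‖ ^ 2

/-- The algorithm accepts every *yes* instance with probability at least `a` and every *no*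
instance with probability at most `b`. -/
def IsTester (alg : QueryAlgorithm d T) (P : UnitaryProperty d) (a b : ℝ) : Prop :=
  (∀ U ∈ P.yes, a ≤ alg.acceptProb U) ∧ (∀ U ∈ P.no, alg.acceptProb U ≤ b)

end QueryAlgorithm

end

open Matrix

section Controlled

variable {d : ℕ}

/-! The yes instance `I` is compared with diagonal no instances. By the hybrid argument
(`acceptProb_sub_acceptProb_le`), the gap `a - b` is at most twice the sum of the single-query
errors, all measured along the run on `I`. For `t / ε`, a global phase `exp (2iε/t)` costs at most
`2ε/t` per query. For `√d`, a phase `exp (iπ/t)` is hidden in one of `d` diagonal entries: in each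
query the squared errors over all positions sum to at most `4`, so Cauchy–Schwarz over the queries
and summation over positions give `d (a - b)² ≤ 16 T²`. -/

theorem controlled_one (m : ℕ) : controlled m (1 : Matrix (Fin d) (Fin d) ℂ) = 1 := by
  have h : Matrix.single (0 : Fin 2) (0 : Fin 2) (1 : ℂ) + Matrix.single 1 1 1 = 1 := by
    ext i j
    fin_cases i <;> fin_cases j <;> simp [Matrix.single]
  rw [controlled, ← Matrix.add_kronecker, h, Matrix.one_kronecker_one, Matrix.one_kronecker_one]

theorem controlled_mul (m : ℕ) (U V : Matrix (Fin d) (Fin d) ℂ) :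
    controlled m U * controlled m V = controlled m (U * V) := by
  simp [controlled, add_mul, mul_add, ← Matrix.mul_kronecker_mul]

theorem controlled_star (m : ℕ) (U : Matrix (Fin d) (Fin d) ℂ) :
    star (controlled m U) = controlled m (star U) := by
  simp [controlled, Matrix.star_eq_conjTranspose, Matrix.conjTranspose_kronecker]

theorem controlled_mem_unitaryGroup (m : ℕ) {U : Matrix (Fin d) (Fin d) ℂ}
    (hU : U ∈ Matrix.unitaryGroup (Fin d) ℂ) :
    controlled m U ∈ Matrix.unitaryGroup (Fin 2 × Fin d × Fin m) ℂ := by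
  rw [Matrix.mem_unitaryGroup_iff, controlled_star, controlled_mul,
    Matrix.mem_unitaryGroup_iff.1 hU, controlled_one]

theorem controlled_diagonal (m : ℕ) (w : Fin d → ℂ) :
    controlled m (diagonal w) =
      diagonal (fun x : Fin 2 × Fin d × Fin m => if x.1 = 0 then 1 else w x.2.1) := by
  ext ⟨i, a, p⟩ ⟨j, b, q⟩
  fin_cases i <;> fin_cases j <;>
    simp [controlled, Matrix.single, Matrix.kroneckerMap_apply, diagonal_apply, Matrix.one_apply,
      Prod.ext_iff, ite_and]
  split_ifs <;> rfl

end Controlled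

section Euclidean

variable {n : Type*} [Fintype n] [DecidableEq n]

theorem norm_toLp_mulVec_of_mem_unitaryGroup {A : Matrix n n ℂ}
    (hA : A ∈ Matrix.unitaryGroup n ℂ) (v : n → ℂ) :
    ‖WithLp.toLp 2 (A *ᵥ v)‖ = ‖WithLp.toLp 2 v‖ := by
  have h : star A * A = 1 := Matrix.mem_unitaryGroup_iff'.1 hA
  have key : inner ℂ (WithLp.toLp 2 (A *ᵥ v)) (WithLp.toLp 2 (A *ᵥ v)) =
      inner ℂ (WithLp.toLp 2 v) (WithLp.toLp 2 v) := by
    rw [EuclideanSpace.inner_toLp_toLp, EuclideanSpace.inner_toLp_toLp, Matrix.star_mulVec,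
      dotProduct_comm, ← Matrix.dotProduct_mulVec, Matrix.mulVec_mulVec,
      ← Matrix.star_eq_conjTranspose, h, Matrix.one_mulVec, dotProduct_comm]
  rw [inner_self_eq_norm_sq_to_K, inner_self_eq_norm_sq_to_K] at key
  have key' : ‖WithLp.toLp 2 (A *ᵥ v)‖ ^ 2 = ‖WithLp.toLp 2 v‖ ^ 2 := by exact_mod_cast key
  exact (sq_eq_sq₀ (norm_nonneg _) (norm_nonneg _)).1 key'

/-- Measurement statistics of unit vectors are Lipschitz in the Euclidean distance. -/
theorem sum_norm_sq_sub_sum_norm_sq_le (S : Finset n) (v w : n → ℂ)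
    (hv : ‖WithLp.toLp 2 v‖ = 1) (hw : ‖WithLp.toLp 2 w‖ = 1) :
    ∑ x ∈ S, ‖v x‖ ^ 2 - ∑ x ∈ S, ‖w x‖ ^ 2 ≤ 2 * ‖WithLp.toLp 2 (v - w)‖ := by
  let P : (n → ℂ) → EuclideanSpace ℂ n := fun u => WithLp.toLp 2 (fun x => if x ∈ S then u x else 0)
  have hP (u : n → ℂ) : ‖P u‖ ^ 2 = ∑ x ∈ S, ‖u x‖ ^ 2 := by
    simp only [P, EuclideanSpace.norm_sq_eq]
    rw [← Finset.sum_subset (Finset.subset_univ S) fun x _ hx => by simp [hx]]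
    exact Finset.sum_congr rfl fun x hx => by simp [hx]
  have hle (u : n → ℂ) : ‖P u‖ ≤ ‖WithLp.toLp 2 u‖ := by
    refine (sq_le_sq₀ (norm_nonneg _) (norm_nonneg _)).1 ?_
    rw [hP, EuclideanSpace.norm_sq_eq]
    exact Finset.sum_le_univ_sum_of_nonneg fun x => sq_nonneg _
  have hsub : P v - P w = P (v - w) := by
    ext x
    by_cases hx : x ∈ S <;> simp [P, hx]
  have h1 : ‖P v‖ - ‖P w‖ ≤ ‖WithLp.toLp 2 (v - w)‖ :=
    (norm_sub_norm_le _ _).trans (hsub ▸ hle (v - w))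
  have h2 := hle v
  have h3 := hle w
  rw [← hP, ← hP]
  -- Difference of squares, with `‖P v‖ + ‖P w‖ ≤ 2`.
  nlinarith [norm_nonneg (P v), norm_nonneg (P w), norm_nonneg (WithLp.toLp 2 (v - w))]

end Euclidean

namespace QueryAlgorithm

variable {d T : ℕ}

theorem query_mem_unitaryGroup (alg : QueryAlgorithm d T) (U : Matrix.unitaryGroup (Fin d) ℂ)
    (j : Fin T) :
    alg.query U j ∈ Matrix.unitaryGroup (Fin 2 × Fin d × Fin alg.m) ℂ := by
  unfold query
  apply controlled_mem_unitaryGroup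
  split_ifs
  · exact (star U).2
  · exact U.2

theorem state_zero (alg : QueryAlgorithm d T) (U : Matrix.unitaryGroup (Fin d) ℂ) :
    alg.state U 0 = (alg.A 0 : Matrix _ _ ℂ) *ᵥ Pi.single alg.init 1 := rfl

theorem state_succ (alg : QueryAlgorithm d T) (U : Matrix.unitaryGroup (Fin d) ℂ) (i : Fin T) :
    alg.state U i.succ =
      (alg.A i.succ : Matrix _ _ ℂ) *ᵥ (alg.query U i *ᵥ alg.state U i.castSucc) := rfl

theorem norm_state (alg : QueryAlgorithm d T) (U : Matrix.unitaryGroup (Fin d) ℂ)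
    (j : Fin (T + 1)) : ‖WithLp.toLp 2 (alg.state U j)‖ = 1 := by
  induction j using Fin.induction with
  | zero =>
    rw [state_zero, norm_toLp_mulVec_of_mem_unitaryGroup (alg.A 0).2]
    simp
  | succ i ih =>
    rw [state_succ, norm_toLp_mulVec_of_mem_unitaryGroup (alg.A i.succ).2,
      norm_toLp_mulVec_of_mem_unitaryGroup (alg.query_mem_unitaryGroup U i), ih]

/-- The error caused by replacing the oracle `U` by `V` in the `i`-th query. -/
noncomputable def queryError (alg : QueryAlgorithm d T) (U V : Matrix.unitaryGroup (Fin d) ℂ) (i : Fin T) : ℝ :=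
  ‖WithLp.toLp 2 ((alg.query U i - alg.query V i) *ᵥ alg.state U i.castSucc)‖

/-- The hybrid argument. -/
theorem norm_state_sub_state_le (alg : QueryAlgorithm d T) (U V : Matrix.unitaryGroup (Fin d) ℂ)
    (j : Fin (T + 1)) :
    ‖WithLp.toLp 2 (alg.state U j - alg.state V j)‖ ≤
      ∑ i with Fin.castSucc i < j, alg.queryError U V i := by
  induction j using Fin.induction with
  | zero => simp [state_zero]
  | succ k ih =>
    have hset : Finset.univ.filter (fun i : Fin T => i.castSucc < k.succ) =
        insert k (Finset.univ.filter fun i : Fin T => i.castSucc < k.castSucc) := by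
      ext i
      simp only [Finset.mem_filter, Finset.mem_univ, true_and, Finset.mem_insert, Fin.lt_def,
        Fin.ext_iff, Fin.val_castSucc, Fin.val_succ]
      omega
    -- The oracle difference is applied to the `U`-run, so the errors involve no state of the
    -- `V`-run; the older error is carried isometrically by the query to `V`.
    have hsplit : alg.query U k *ᵥ alg.state U k.castSucc -
        alg.query V k *ᵥ alg.state V k.castSucc =
        (alg.query U k - alg.query V k) *ᵥ alg.state U k.castSucc +
          alg.query V k *ᵥ (alg.state U k.castSucc - alg.state V k.castSucc) := by
      rw [Matrix.sub_mulVec, Matrix.mulVec_sub]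
      abel
    rw [hset, Finset.sum_insert (by simp), state_succ, state_succ, ← Matrix.mulVec_sub,
      norm_toLp_mulVec_of_mem_unitaryGroup (alg.A k.succ).2, hsplit, WithLp.toLp_add]
    refine (norm_add_le _ _).trans (add_le_add le_rfl ?_)
    rwa [norm_toLp_mulVec_of_mem_unitaryGroup (alg.query_mem_unitaryGroup V k)]

theorem acceptProb_sub_acceptProb_le (alg : QueryAlgorithm d T)
    (U V : Matrix.unitaryGroup (Fin d) ℂ) :
    alg.acceptProb U - alg.acceptProb V ≤ 2 * ∑ i, alg.queryError U V i := by
  refine (sum_norm_sq_sub_sum_norm_sq_le _ _ _ (alg.norm_state U _) (alg.norm_state V _)).trans ?_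
  have h := alg.norm_state_sub_state_le U V (Fin.last T)
  rw [Finset.filter_true_of_mem fun i _ => Fin.castSucc_lt_last i] at h
  linarith

end QueryAlgorithm

/-- The diagonal unitary matrix with the given phases. -/
def phaseUnitary {d : ℕ} (w : Fin d → Circle) : Matrix.unitaryGroup (Fin d) ℂ :=
  ⟨diagonal fun k => (w k : ℂ), by
    rw [Matrix.mem_unitaryGroup_iff, Matrix.star_eq_conjTranspose, diagonal_conjTranspose,
      diagonal_mul_diagonal, ← diagonal_one]
    congr 1
    ext k
    simp [Complex.mul_conj]⟩

theorem norm_phaseUnitary_pow_sub_one {d : ℕ} (w : Fin d → Circle) (t : ℕ) (k : Fin d) :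
    ‖(w k : ℂ) ^ t - 1‖ ≤
      ‖(phaseUnitary w : Matrix (Fin d) (Fin d) ℂ) ^ t - 1‖ := by
  have h : (phaseUnitary w : Matrix (Fin d) (Fin d) ℂ) ^ t - 1 =
      diagonal (fun k => (w k : ℂ) ^ t - 1) := by
    rw [phaseUnitary, diagonal_pow, ← diagonal_one, diagonal_sub]
    rfl
  rw [h, Matrix.l2_opNorm_diagonal]
  exact norm_le_pi_norm (fun k => (w k : ℂ) ^ t - 1) k

namespace QueryAlgorithm

variable {d T : ℕ}

/-- Both queries are diagonal, so the error splits over basis states: control `0` contributes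
nothing, and an inverse query only conjugates `1 - w`. -/
theorem sq_queryError_one_phaseUnitary_le (alg : QueryAlgorithm d T) (w : Fin d → Circle)
    (i : Fin T) :
    alg.queryError 1 (phaseUnitary w) i ^ 2 ≤
      ∑ x, ‖1 - (w x.2.1 : ℂ)‖ ^ 2 * ‖alg.state 1 i.castSucc x‖ ^ 2 := by
  have h1 : alg.query 1 i = 1 := by simp [query, controlled_one]
  have hw : alg.query (phaseUnitary w) i = diagonal (fun x =>
      if x.1 = 0 then 1 else if alg.inverse i then star (w x.2.1 : ℂ) else (w x.2.1 : ℂ)) := by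
    unfold query phaseUnitary
    split_ifs with h
    · rw [Matrix.star_eq_conjTranspose, diagonal_conjTranspose, controlled_diagonal]
      rfl
    · exact controlled_diagonal _ _
  rw [queryError, EuclideanSpace.norm_sq_eq, h1, hw, ← diagonal_one, diagonal_sub]
  refine Finset.sum_le_sum fun x _ => ?_
  rw [PiLp.toLp_apply, mulVec_diagonal, norm_mul, mul_pow]
  refine mul_le_mul_of_nonneg_right (pow_le_pow_left₀ (norm_nonneg _) ?_ 2) (sq_nonneg _)
  split_ifs
  · simp
  · rw [← norm_star]
    simp
  · rfl

theorem sum_norm_sq_state (alg : QueryAlgorithm d T) (U : Matrix.unitaryGroup (Fin d) ℂ)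
    (j : Fin (T + 1)) : ∑ x, ‖alg.state U j x‖ ^ 2 = 1 := by
  have h := EuclideanSpace.norm_sq_eq (WithLp.toLp 2 (alg.state U j))
  rw [norm_state] at h
  simpa using h.symm

/-- A global phase is detected only at the rate at which it differs from `1`. -/
theorem queryError_one_phaseUnitary_const_le (alg : QueryAlgorithm d T) (z : Circle) (i : Fin T) :
    alg.queryError 1 (phaseUnitary fun _ => z) i ≤ ‖1 - (z : ℂ)‖ := by
  refine (sq_le_sq₀ (norm_nonneg _) (norm_nonneg _)).1 ?_
  refine (alg.sq_queryError_one_phaseUnitary_le _ i).trans ?_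
  rw [← Finset.mul_sum, sum_norm_sq_state, mul_one]

/-- A basis state notices the hidden phase only when `k` is its query index, so each weight is
counted once and the bound is independent of `d`. -/
theorem sum_sq_queryError_one_phaseUnitary_mulSingle_le (alg : QueryAlgorithm d T) (z : Circle)
    (i : Fin T) :
    ∑ k, alg.queryError 1 (phaseUnitary (Pi.mulSingle k z)) i ^ 2 ≤ 4 := by
  have hz : ‖1 - (z : ℂ)‖ ^ 2 ≤ 4 := by
    have h := norm_sub_le (1 : ℂ) (z : ℂ)
    rw [norm_one, Circle.norm_coe] at h
    nlinarith [norm_nonneg (1 - (z : ℂ))]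
  calc ∑ k, alg.queryError 1 (phaseUnitary (Pi.mulSingle k z)) i ^ 2
    _ ≤ ∑ k, ∑ x, ‖1 - ((Pi.mulSingle k z : Fin d → Circle) x.2.1 : ℂ)‖ ^ 2 *
          ‖alg.state 1 i.castSucc x‖ ^ 2 :=
        Finset.sum_le_sum fun k _ => alg.sq_queryError_one_phaseUnitary_le _ i
    _ = ∑ x, ‖1 - (z : ℂ)‖ ^ 2 * ‖alg.state 1 i.castSucc x‖ ^ 2 := by
        rw [Finset.sum_comm]
        refine Finset.sum_congr rfl fun x _ => ?_
        rw [Finset.sum_eq_single x.2.1]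
        · simp
        · intro k _ hk
          simp [Pi.mulSingle_eq_of_ne hk.symm]
        · simp
    _ ≤ 4 := by rw [← Finset.mul_sum, sum_norm_sq_state, mul_one]; exact hz

variable {t : ℕ} {ε a b : ℝ}

theorem IsTester.sub_le_sum_queryError {alg : QueryAlgorithm d T}
    (h : alg.IsTester (recurrenceTime d t ε) a b) (w : Fin d → Circle) (k : Fin d)
    (hw : ε ≤ ‖(w k : ℂ) ^ t - 1‖) :
    a - b ≤ 2 * ∑ i, alg.queryError 1 (phaseUnitary w) i := by
  have h1 := h.1 1 (one_pow t)
  have h2 := h.2 (phaseUnitary w) (hw.trans (norm_phaseUnitary_pow_sub_one w t k))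
  linarith [alg.acceptProb_sub_acceptProb_le 1 (phaseUnitary w)]

theorem IsTester.le_of_globalPhase {alg : QueryAlgorithm d T}
    (h : alg.IsTester (recurrenceTime d t ε) a b) (hd : 1 ≤ d) (ht : 1 ≤ t) (hε : 0 < ε)
    (hε' : ε ≤ Real.pi / 2) : (a - b) / 4 * (t / ε) ≤ T := by
  have ht0 : (0 : ℝ) < t := by exact_mod_cast ht
  -- The factor `2` gives `‖z ^ t - 1‖ = 2 sin ε`, which is at least `ε` by Jordan's inequality and
  -- `π ≤ 4`.
  set z : Circle := Circle.exp (2 * ε / t) with hz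
  have hpow : ε ≤ ‖(z : ℂ) ^ t - 1‖ := by
    have h1 : (z : ℂ) ^ t = Complex.exp (Complex.I * ((2 * ε : ℝ) : ℂ)) := by
      rw [hz, Circle.coe_exp, ← Complex.exp_nat_mul]
      congr 1
      have : (t : ℂ) ≠ 0 := by exact_mod_cast ht0.ne'
      push_cast
      field_simp
    rw [h1, Complex.norm_exp_I_mul_ofReal_sub_one, mul_div_cancel_left₀ _ two_ne_zero]
    have h2 := Real.mul_le_sin hε.le hε'
    have h3 : 1 / 2 * ε ≤ 2 / Real.pi * ε := by
      refine mul_le_mul_of_nonneg_right ?_ hε.le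
      rw [div_le_div_iff₀ two_pos Real.pi_pos]
      linarith [Real.pi_le_four]
    rw [Real.norm_eq_abs]
    exact le_trans (by linarith) (le_abs_self _)
  have hdist : ‖1 - (z : ℂ)‖ ≤ 2 * ε / t := by
    rw [norm_sub_rev, hz, Circle.coe_exp, mul_comm]
    refine (Real.norm_exp_I_mul_ofReal_sub_one_le).trans ?_
    rw [Real.norm_of_nonneg (by positivity)]
  have h1 := h.sub_le_sum_queryError (fun _ => z) ⟨0, hd⟩ hpow
  have h2 : ∑ i, alg.queryError 1 (phaseUnitary fun _ => z) i ≤ T * (2 * ε / t) := by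
    refine (Finset.sum_le_sum fun i _ =>
      (alg.queryError_one_phaseUnitary_const_le z i).trans hdist).trans ?_
    simp
  have h3 : a - b ≤ 4 * T * (ε / t) := by
    calc a - b ≤ 2 * (T * (2 * ε / t)) := by linarith
      _ = 4 * T * (ε / t) := by ring
  calc (a - b) / 4 * (t / ε) ≤ (4 * T * (ε / t)) / 4 * (t / ε) := by gcongr
    _ = T := by field_simp

theorem IsTester.le_of_hiddenPhase {alg : QueryAlgorithm d T}
    (h : alg.IsTester (recurrenceTime d t ε) a b) (hab : b < a) (ht : 1 ≤ t)
    (hε' : ε ≤ 2) : (a - b) / 4 * √d ≤ T := by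
  have ht0 : (t : ℂ) ≠ 0 := by exact_mod_cast (by omega : t ≠ 0)
  -- Now `z ^ t = -1`, at the maximal distance `2` from `1`.
  set z : Circle := Circle.exp (Real.pi / t) with hz
  have hpow : ε ≤ ‖(z : ℂ) ^ t - 1‖ := by
    have h1 : (z : ℂ) ^ t = -1 := by
      rw [hz, Circle.coe_exp, ← Complex.exp_nat_mul, ← Complex.exp_pi_mul_I]
      congr 1
      push_cast
      field_simp
    rw [h1]
    norm_num
    exact hε'
  -- Cauchy–Schwarz over the `T` queries, to reach the squared errors that can be summed over `k`.
  have h1 (k : Fin d) : (a - b) ^ 2 ≤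
      4 * T * ∑ i, alg.queryError 1 (phaseUnitary (Pi.mulSingle k z)) i ^ 2 := by
    have h2 := h.sub_le_sum_queryError (Pi.mulSingle k z) k (by simpa using hpow)
    have h3 := sq_sum_le_card_mul_sum_sq (s := Finset.univ)
      (f := fun i => alg.queryError 1 (phaseUnitary (Pi.mulSingle k z)) i)
    rw [Finset.card_univ, Fintype.card_fin] at h3
    nlinarith
  have h2 : d * (a - b) ^ 2 ≤ 16 * (T : ℝ) ^ 2 := by
    calc d * (a - b) ^ 2 = ∑ _k : Fin d, (a - b) ^ 2 := by simp
      _ ≤ ∑ k, 4 * T * ∑ i, alg.queryError 1 (phaseUnitary (Pi.mulSingle k z)) i ^ 2 :=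
          Finset.sum_le_sum fun k _ => h1 k
      _ = 4 * T * ∑ i, ∑ k, alg.queryError 1 (phaseUnitary (Pi.mulSingle k z)) i ^ 2 := by
          rw [← Finset.mul_sum, Finset.sum_comm]
      _ ≤ 4 * T * ∑ _i : Fin T, 4 := by
          gcongr with i
          exact alg.sum_sq_queryError_one_phaseUnitary_mulSingle_le z i
      _ = 16 * (T : ℝ) ^ 2 := by simp; ring
  refine (sq_le_sq₀ (mul_nonneg (by linarith) (Real.sqrt_nonneg _)) (Nat.cast_nonneg T)).1 ?_
  rw [mul_pow, Real.sq_sqrt (Nat.cast_nonneg d)]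
  nlinarith

end QueryAlgorithm

theorem mainTheorem4 (a b : ℝ) (hab : b < a) :
    ∃ c : ℝ, 0 < c ∧
      ∀ (d t T : ℕ) (ε : ℝ), 1 ≤ d → 1 ≤ t → 0 < ε → ε ≤ 1 / (2 * Real.pi) →
        ∀ alg : QueryAlgorithm d T, alg.IsTester (recurrenceTime d t ε) a b →
          c * max ((t : ℝ) / ε) (Real.sqrt (d : ℝ)) ≤ (T : ℝ) := by
  have hc : 0 < (a - b) / 4 := by linarith
  refine ⟨(a - b) / 4, hc, fun d t T ε hd ht hε hε' alg h => ?_⟩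
  have hε1 : ε ≤ 1 := hε'.trans <| by
    rw [div_le_one (by positivity)]
    linarith [Real.pi_gt_three]
  rw [mul_max_of_nonneg _ _ hc.le]
  exact max_le (h.le_of_globalPhase hd ht hε (by linarith [Real.pi_gt_three]))
    (h.le_of_hiddenPhase hab ht (by linarith))
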